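/- Let $\mathsf{S}$ be the class of all finite semigroups and, for a prime $p$, let $\mathsf{G}_p$ be the class of all finite $p$-groups. For a finite alphabet $A$ and $\mathsf V\in\{\mathsf S,\mathsf G_p\}$ let $\overline\Omega_A\mathsf V$ be the free pro-$\mathsf V$ semigroup over $A$, whose elements are identified with the $A$-ary implicit operations on $\mathsf V$, that is, the families of maps $w_S\colon S^A\to S$ $(S\in\mathsf V)$ that commute with all homomorphisms. A pseudoidentity $u=v$ with $u,v\in\overline\Omega_A\mathsf S$ is valid in $\mathsf V$ if $u_S=v_S$ for all $S\in\mathsf V$. Let $\kappa$ be the signature consisting of multiplication and the unary operation $x\mapsto x^{\omega-1}$, where, for $s$ in a finite semigroup with $N$ elements, $s^{\omega-1}$ is the inverse of $s^{1+N!}$ in the cyclic group generated by this power. Let $\sigma$ be obtained by adding to $\kappa$ all implicit operations $$\left(a_j\circ(w_1,\dots,w_n)^{\omega}\right)^{m^{\omega}},$$ where $m\ge 1$, $1\le j\le n$, and $w_1,\dots,w_n$ are $\kappa$-terms in the letters $a_1,\dots,a_n$ such that the $n\times n$ integer matrix $M$, whose $(i,k)$ entry is the sum of the exponents of the occurrences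 of $a_k$ in $w_i$ (reading $\omega-1$ as $-1$), has $\det M\neq 0$ and every prime dividing $\det M$ divides $m$. Here $a_j\circ(w_1,\dots,w_n)^\omega$ is the $j$-th component of the idempotent power of the operator $(w_1,\dots,w_n)$ on $S^n$, and $x^{m^\omega}=\lim_{k\to\infty}x^{m^{k!}}$. For $\tau\in\{\kappa,\sigma\}$ let $\Omega^\tau_A\mathsf V$ be the $\tau$-subalgebra of $\overline\Omega_A\mathsf V$ generated by $A$. An implicit operation $w$ on $\mathsf V$ is computable if there is an algorithm that, given $S\in\mathsf V$ and $\varphi\in S^A$, outputs $w_S(\varphi)$. Theorem. Let $A$ be a finite alphabet. (1) For every $u\in\Omega^\sigma_A\mathsf S$ there is a computable cofinite subset $S(u)$ of the set $\mathbb P$ of primes such that: there is a computable $w_0\in\Omega^\kappa_A\mathsf S$ such that $u=w_0$ is valid in $\mathsf G_p$ for every $p\in S(u)$; and for each of the finitely many primes $p_i\in\mathbb P\setminus S(u)$ there is a computable $w_i\in\Omega^\kappa_A\mathsf S$ such that $u=w_i$ is valid in $\mathsf G_{p_i}$. (2) These data can be found effectively: there are algorithms which, given a $\sigma$-term $u$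 over $A$, compute the finite list of primes $\mathbb P\setminus S(u)$, a $\kappa$-term for $w_0$, and, given moreover a prime $p_i$ in this list, a $\kappa$-term for $w_i$, with the properties stated in (1). (3) For every prime $p$, $\Omega^\sigma_A\mathsf G_p=\Omega^\kappa_A\mathsf G_p$. -/

import Mathlib

open Filter

namespace Pseudo

/-! ### Powers in finite semigroups -/

section Powers

variable {S T : Type*} [Semigroup S] [Semigroup T]

/-- `powSucc s k` is the power `s ^ (k + 1)` in a semigroup. -/
def powSucc (s : S) : ℕ → S
  | 0 => s
  | k + 1 => powSucc s k * s

theorem coe_powSucc (s : S) (k : ℕ) :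
    ((powSucc s k : S) : WithOne S) = (s : WithOne S) ^ (k + 1) := by
  induction k with
  | zero => simp [powSucc]
  | succ k ih => rw [powSucc, WithOne.coe_mul, ih, pow_succ (s : WithOne S) (k + 1)]

theorem map_powSucc (f : S →ₙ* T) (s : S) (k : ℕ) :
    f (powSucc s k) = powSucc (f s) k := by
  induction k with
  | zero => rfl
  | succ k ih => rw [powSucc, map_mul, ih, powSucc]

theorem exists_period [Finite S] (s : S) :
    ∃ i q : ℕ, 0 < q ∧ i ≤ Nat.card S ∧ q ≤ Nat.card S ∧
      ∀ a, i ≤ a → ∀ c, (s : WithOne S) ^ (a + q * c) = (s : WithOne S) ^ a := by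
  classical
  have := Fintype.ofFinite S
  obtain ⟨a, b, hab, h⟩ := Fintype.exists_ne_map_eq_of_card_lt
    (fun k : Fin (Nat.card S + 1) => powSucc s k) (by simp [Nat.card_eq_fintype_card])
  wlog hlt : a < b generalizing a b
  · exact this b a hab.symm h.symm (lt_of_le_of_ne (not_lt.1 hlt) hab.symm)
  have hlt' : (a : ℕ) < b := hlt
  have hb := b.isLt
  refine ⟨a + 1, b - a, by omega, by omega, by omega, ?_⟩
  have h0 : (s : WithOne S) ^ ((a : ℕ) + 1 + (b - a)) = (s : WithOne S) ^ ((a : ℕ) + 1) := by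
    rw [← coe_powSucc s a, h, coe_powSucc]
    congr 1; omega
  intro x hx c
  obtain ⟨d, rfl⟩ := Nat.exists_eq_add_of_le hx
  induction c with
  | zero => simp
  | succ c ih =>
    rw [← ih, show (a : ℕ) + 1 + d + (b - a) * (c + 1)
      = ((a : ℕ) + 1 + (b - a)) + (d + (b - a) * c) by ring, pow_add, h0, ← pow_add]
    congr 1; ring

/-- The idempotent power `s ^ ω = s ^ (N !)` of an element of a finite semigroup with `N`
elements. -/
noncomputable def omegaPow (s : S) : S := powSucc s ((Nat.card S).factorial - 1)

/-- `s ^ (ω - 1) = s ^ (2 N ! - 1)`, in a finite semigroup with `N` elements: the inverse of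
`s ^ (1 + N !)` in the cyclic group generated by that power. -/
noncomputable def omegaInv (s : S) : S := powSucc s (2 * (Nat.card S).factorial - 2)

theorem coe_omegaPow (s : S) :
    ((omegaPow s : S) : WithOne S) = (s : WithOne S) ^ (Nat.card S).factorial := by
  have := Nat.factorial_pos (Nat.card S)
  rw [omegaPow, coe_powSucc]; congr 1; omega

theorem coe_omegaInv (s : S) :
    ((omegaInv s : S) : WithOne S) = (s : WithOne S) ^ (2 * (Nat.card S).factorial - 1) := by
  have := Nat.factorial_pos (Nat.card S)
  rw [omegaInv, coe_powSucc]; congr 1; omega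

theorem omegaPow_idem [Finite S] (s : S) : omegaPow s * omegaPow s = omegaPow s := by
  apply WithOne.coe_injective
  obtain ⟨i, q, hq, hi, hqN, h⟩ := exists_period s
  obtain ⟨c, hc⟩ := Nat.dvd_factorial hq hqN
  rw [WithOne.coe_mul, coe_omegaPow, ← pow_add]
  nth_rewrite 2 [hc]
  exact h _ (hi.trans (Nat.self_le_factorial _)) c

/-- Two idempotent powers of the same element of a monoid coincide. -/
theorem idem_pow_unique {M : Type*} [Monoid M] {x : M} {a b : ℕ} (ha : a ≠ 0) (hb : b ≠ 0)
    (h1 : x ^ a * x ^ a = x ^ a) (h2 : x ^ b * x ^ b = x ^ b) : x ^ a = x ^ b := by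
  have e1 : (x ^ a) ^ b = x ^ a := IsIdempotentElem.pow_eq h1 hb
  have e2 : (x ^ b) ^ a = x ^ b := IsIdempotentElem.pow_eq h2 ha
  rw [← e1, ← e2, ← pow_mul, ← pow_mul, mul_comm]

theorem mul_omegaInv (s : S) : s * omegaInv s = omegaPow s * omegaPow s := by
  apply WithOne.coe_injective
  have := Nat.factorial_pos (Nat.card S)
  rw [WithOne.coe_mul, WithOne.coe_mul, coe_omegaInv, coe_omegaPow, ← pow_succ', ← pow_add]
  congr 1; omega

/-- The defining property of `s ^ (ω - 1)`: it is the inverse of `s ^ (1 + N !)` in the group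
with identity element `s ^ ω`. -/
theorem omegaInv_spec [Finite S] (s : S) :
    powSucc s (Nat.card S).factorial * omegaInv s = omegaPow s ∧
      omegaInv s * powSucc s (Nat.card S).factorial = omegaPow s ∧
      omegaPow s * omegaInv s = omegaInv s := by
  have hN := Nat.factorial_pos (Nat.card S)
  have hid := congrArg (fun t : S => (t : WithOne S)) (omegaPow_idem s)
  simp only [WithOne.coe_mul, coe_omegaPow] at hid
  refine ⟨?_, ?_, ?_⟩ <;> apply WithOne.coe_injective <;>
    simp only [WithOne.coe_mul, coe_omegaPow, coe_omegaInv, coe_powSucc]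
  · rw [← pow_add, show (Nat.card S).factorial + 1 + (2 * (Nat.card S).factorial - 1)
      = (Nat.card S).factorial + (Nat.card S).factorial + (Nat.card S).factorial by omega, pow_add, pow_add, hid, hid]
  · rw [← pow_add, show 2 * (Nat.card S).factorial - 1 + ((Nat.card S).factorial + 1)
      = (Nat.card S).factorial + (Nat.card S).factorial + (Nat.card S).factorial by omega, pow_add, pow_add, hid, hid]
  · rw [show 2 * (Nat.card S).factorial - 1 = (Nat.card S).factorial + ((Nat.card S).factorial - 1) by omega,
      pow_add, ← mul_assoc, hid]

theorem map_omegaPow [Finite S] [Finite T] (f : S →ₙ* T) (s : S) :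
    f (omegaPow s) = omegaPow (f s) := by
  have h1 := congrArg (fun t : S => ((f t : T) : WithOne T)) (omegaPow_idem s)
  have h2 := congrArg (fun t : T => (t : WithOne T)) (omegaPow_idem (f s))
  have e : ((f (omegaPow s) : T) : WithOne T) = ((f s : T) : WithOne T) ^ (Nat.card S).factorial := by
    have := Nat.factorial_pos (Nat.card S)
    rw [omegaPow, map_powSucc, coe_powSucc]; congr 1; omega
  apply WithOne.coe_injective
  simp only [map_mul, WithOne.coe_mul, e, coe_omegaPow] at h1 h2 ⊢
  exact idem_pow_unique (Nat.factorial_ne_zero _) (Nat.factorial_ne_zero _) h1 h2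

theorem map_omegaInv [Finite S] [Finite T] (f : S →ₙ* T) (s : S) :
    f (omegaInv s) = omegaInv (f s) := by
  have a1 : f s * f (omegaInv s) = omegaPow (f s) := by
    rw [← map_mul, mul_omegaInv, omegaPow_idem, map_omegaPow]
  have a2 : f s * omegaInv (f s) = omegaPow (f s) := by rw [mul_omegaInv, omegaPow_idem]
  have b1 : omegaPow (f s) * f (omegaInv s) = f (omegaInv s) := by
    rw [← map_omegaPow, ← map_mul, (omegaInv_spec s).2.2]
  have b2 : omegaPow (f s) * omegaInv (f s) = omegaInv (f s) := (omegaInv_spec (f s)).2.2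
  have c : f (omegaInv s) * omegaInv (f s) = omegaInv (f s) * f (omegaInv s) := by
    apply WithOne.coe_injective
    rw [WithOne.coe_mul, WithOne.coe_mul, coe_omegaInv (f s), omegaInv, map_powSucc, coe_powSucc,
      ← pow_add, ← pow_add, add_comm]
  have d : f s * omegaInv (f s) = omegaInv (f s) * f s := by
    apply WithOne.coe_injective
    rw [WithOne.coe_mul, WithOne.coe_mul, coe_omegaInv (f s), ← pow_succ', ← pow_succ]
  calc f (omegaInv s) = f s * omegaInv (f s) * f (omegaInv s) := by rw [a2, b1]
    _ = omegaInv (f s) * (f s * f (omegaInv s)) := by rw [d, mul_assoc]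
    _ = omegaInv (f s) * (f s * omegaInv (f s)) := by rw [a1, a2]
    _ = f s * omegaInv (f s) * omegaInv (f s) := by rw [← mul_assoc, ← d]
    _ = omegaInv (f s) := by rw [a2, b2]

/-- In a finite semigroup the sequence `s ^ (m ^ (k !))` is eventually constant. -/
theorem exists_natOmegaPow [Finite S] (m : ℕ) (s : S) :
    ∃ t : S, ∀ᶠ k : ℕ in atTop, powSucc s (m ^ k.factorial - 1) = t := by
  rcases Nat.lt_or_ge m 2 with hm | hm
  · refine ⟨s, Eventually.of_forall fun k => ?_⟩
    have : m ^ k.factorial - 1 = 0 := by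
      interval_cases m
      · simp [Nat.factorial_ne_zero]
      · simp
    rw [this]; rfl
  obtain ⟨i, q, hq, -, -, h⟩ := exists_period s
  have : NeZero q := ⟨hq.ne'⟩
  obtain ⟨i', q', hq', -, -, h'⟩ := exists_period (m : ZMod q)
  -- the residue class of `m ^ (k !)` modulo `q` is constant for large `k`
  have hstep : ∀ a, i' ≤ a → 0 < a → ∀ c, m ^ (a + q' * c) ≡ m ^ a [MOD q] := by
    intro a ha ha0 c
    have key : ∀ b, 0 < b → (((m : ZMod q) ^ b : ZMod q) : WithOne (ZMod q))
        = ((m : ZMod q) : WithOne (ZMod q)) ^ b := by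
      intro b hb
      obtain ⟨d, rfl⟩ := Nat.exists_eq_succ_of_ne_zero hb.ne'
      clear hb
      induction d with
      | zero => simp
      | succ d ih => rw [pow_succ, WithOne.coe_mul, ih, ← pow_succ]
    have e := h' a ha c
    rw [← key _ (by omega), ← key _ ha0] at e
    have e2 := WithOne.coe_injective e
    rw [← ZMod.natCast_eq_natCast_iff]
    push_cast
    exact e2
  have hmod : ∀ k l, max i (max i' (max q' 1)) ≤ k → k ≤ l →
      powSucc s (m ^ l.factorial - 1) = powSucc s (m ^ k.factorial - 1) := by
    intro k l hk hkl
    have hik : i ≤ k := le_trans (le_max_left _ _) hk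
    have hi'k : i' ≤ k := le_trans (le_trans (le_max_left _ _) (le_max_right _ _)) hk
    have hq'k : q' ≤ k := le_trans (le_trans (le_max_left _ _)
      (le_trans (le_max_right _ _) (le_max_right _ _))) hk
    have hkf := Nat.self_le_factorial k
    have hle : k.factorial ≤ l.factorial := Nat.factorial_le hkl
    obtain ⟨c, hc⟩ : q' ∣ l.factorial - k.factorial :=
      Nat.dvd_sub (Nat.dvd_factorial hq' (hq'k.trans hkl)) (Nat.dvd_factorial hq' hq'k)
    have e1 := hstep k.factorial (hi'k.trans hkf) (Nat.factorial_pos k) c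
    rw [← hc, Nat.add_sub_cancel' hle] at e1
    have hpw : m ^ k.factorial ≤ m ^ l.factorial := Nat.pow_le_pow_right (by omega) hle
    obtain ⟨d, hd⟩ := (Nat.modEq_iff_dvd' hpw).1 e1.symm
    have hpos : 0 < m ^ k.factorial := Nat.pow_pos (by omega)
    have hbig : k.factorial < m ^ k.factorial := Nat.lt_pow_self (by omega)
    apply WithOne.coe_injective
    rw [coe_powSucc, coe_powSucc, Nat.sub_add_cancel (by omega), Nat.sub_add_cancel (by omega),
      show m ^ l.factorial = m ^ k.factorial + q * d by omega]
    exact h _ (by omega) d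
  exact ⟨_, eventually_atTop.2 ⟨max i (max i' (max q' 1)), fun l hl => hmod _ l le_rfl hl⟩⟩

/-- `s ^ (m ^ ω)`: the limit, that is the eventual value, of `s ^ (m ^ (k !))` as `k → ∞`. -/
noncomputable def natOmegaPow [Finite S] (m : ℕ) (s : S) : S :=
  Classical.choose (exists_natOmegaPow m s)

theorem natOmegaPow_spec [Finite S] (m : ℕ) (s : S) :
    ∀ᶠ k : ℕ in atTop, powSucc s (m ^ k.factorial - 1) = natOmegaPow m s :=
  Classical.choose_spec (exists_natOmegaPow m s)

theorem map_natOmegaPow [Finite S] [Finite T] (f : S →ₙ* T) (m : ℕ) (s : S) :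
    f (natOmegaPow m s) = natOmegaPow m (f s) := by
  obtain ⟨k, h1, h2⟩ := ((natOmegaPow_spec m s).and (natOmegaPow_spec m (f s))).exists
  rw [← h1, ← h2, map_powSucc]

end Powers

/-! ### Implicit operations -/

/-- Finite semigroups. -/
structure FinSemigrp where
  carrier : Type
  [semigroup : Semigroup carrier]
  [finite : Finite carrier]

attribute [instance] FinSemigrp.semigroup FinSemigrp.finite

/-- The pseudovariety `S` of all finite semigroups. -/
def allS : FinSemigrp → Prop := fun _ => True

/-- The pseudovariety `G_p` of all finite `p`-groups, as a class of finite semigroups. -/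
def Gp (p : ℕ) : FinSemigrp → Prop := fun S =>
  ∃ (G : Type) (_ : Group G), IsPGroup p G ∧ Nonempty (S.carrier ≃* G)

/-- The free pro-`V` semigroup over `A`, presented as the set of all `A`-ary implicit operations
on `V`: families of maps `S ^ A → S`, for `S` in `V`, that commute with all homomorphisms. -/
@[ext]
structure ImplicitOp (V : FinSemigrp → Prop) (A : Type*) where
  val : ∀ S : FinSemigrp, V S → (A → S.carrier) → S.carrier
  natural : ∀ (S T : FinSemigrp) (hS : V S) (hT : V T) (f : S.carrier →ₙ* T.carrier)
    (φ : A → S.carrier), f (val S hS φ) = val T hT (fun a => f (φ a))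

namespace ImplicitOp

variable {V : FinSemigrp → Prop} {A : Type*}

/-- The generator (component projection) given by a letter. -/
def proj (V : FinSemigrp → Prop) (a : A) : ImplicitOp V A where
  val _ _ φ := φ a
  natural _ _ _ _ _ _ := rfl

/-- The natural continuous homomorphism from the free profinite semigroup to the free pro-`V`
semigroup: restriction of implicit operations to the members of `V`. -/
def restrict (V : FinSemigrp → Prop) (u : ImplicitOp allS A) : ImplicitOp V A where
  val S _ φ := u.val S trivial φ
  natural S T _ _ f φ := u.natural S T trivial trivial f φ

/-- The natural interpretation of an `n`-ary implicit operation on finite semigroups as an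
`n`-ary operation on the free pro-`V` semigroup. -/
def app {n : ℕ} (w : ImplicitOp allS (Fin n)) (u : Fin n → ImplicitOp V A) : ImplicitOp V A where
  val S hS φ := w.val S trivial (fun i => (u i).val S hS φ)
  natural S T hS hT f φ := by
    rw [w.natural S T trivial trivial f]
    congr 1
    funext i
    exact (u i).natural S T hS hT f φ

end ImplicitOp

/-- The pseudoidentity `u = v` is valid in `V`. -/
def Satisfies {A : Type*} (V : FinSemigrp → Prop) (u v : ImplicitOp allS A) : Prop :=
  u.restrict V = v.restrict V

/-- Multiplication as a binary implicit operation. -/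
def mulOp : ImplicitOp allS (Fin 2) where
  val _ _ φ := φ 0 * φ 1
  natural _ _ _ _ f φ := map_mul f (φ 0) (φ 1)

/-- The unary implicit operation `x ↦ x ^ (ω - 1)`. -/
noncomputable def omegaInvOp : ImplicitOp allS (Fin 1) where
  val _ _ φ := omegaInv (φ 0)
  natural _ _ _ _ f φ := map_omegaInv f (φ 0)

/-- A set of implicit operations on finite semigroups, each with its arity. -/
abbrev Signature := Set (Σ n : ℕ, ImplicitOp allS (Fin n))

/-- The canonical signature. -/
def kappa : Signature := {⟨2, mulOp⟩, ⟨1, omegaInvOp⟩}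

/-- `Omega τ V A` is the `τ`-subalgebra generated by (the image of) `A` in the free pro-`V`
semigroup over `A`. -/
inductive Omega (τ : Signature) (V : FinSemigrp → Prop) (A : Type*) : Set (ImplicitOp V A)
  | gen (a : A) : Omega τ V A (ImplicitOp.proj V a)
  | app {n : ℕ} (w : ImplicitOp allS (Fin n)) (hw : (⟨n, w⟩ : Σ n, ImplicitOp allS (Fin n)) ∈ τ)
      (u : Fin n → ImplicitOp V A) (hu : ∀ i, Omega τ V A (u i)) :
      Omega τ V A (w.app u)

/-! ### Terms -/

/-- `κ`-terms over an alphabet; `inv t` stands for `t ^ (ω - 1)`. -/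
inductive KTerm (X : Type*) : Type _
  | var (x : X) : KTerm X
  | mul (s t : KTerm X) : KTerm X
  | inv (t : KTerm X) : KTerm X

namespace KTerm

variable {X : Type*}

/-- The pseudoword represented by a `κ`-term. -/
noncomputable def eval : KTerm X → ImplicitOp allS X
  | var x => ImplicitOp.proj allS x
  | mul s t => mulOp.app ![s.eval, t.eval]
  | inv t => omegaInvOp.app ![t.eval]

/-- The sum of the exponents of the occurrences of the letter `x`, when `t ^ (ω - 1)` is read as
the inverse of `t` in the free group. -/
def expSum [DecidableEq X] (x : X) : KTerm X → ℤ
  | var y => if y = x then 1 else 0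
  | mul s t => expSum x s + expSum x t
  | inv t => - expSum x t

/-- The code of a `κ`-term in Polish notation: `0` is multiplication, `1` is the `(ω - 1)`-power,
and `idx x + 2` is the letter `x`, where `idx` numbers the letters. -/
def code (idx : X → ℕ) : KTerm X → List ℕ
  | var x => [idx x + 2]
  | mul s t => 0 :: (code idx s ++ code idx t)
  | inv t => 1 :: code idx t

end KTerm

/-- The operator `(w_1, …, w_n)` on `S ^ n` given by `n`-ary `κ`-terms, as an element of the finite
monoid of self-maps of `S ^ n`. -/
noncomputable def operator {n : ℕ} (w : Fin n → KTerm (Fin n)) (S : FinSemigrp) :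
    Function.End (Fin n → S.carrier) :=
  fun φ i => (w i).eval.val S trivial φ

instance {α : Type*} [Finite α] : Finite (Function.End α) :=
  inferInstanceAs (Finite (α → α))

theorem operator_pow_natural {n : ℕ} (w : Fin n → KTerm (Fin n)) (S T : FinSemigrp)
    (f : S.carrier →ₙ* T.carrier) (k : ℕ) (φ : Fin n → S.carrier) :
    (fun i => f ((operator w S ^ k) φ i)) = (operator w T ^ k) (fun i => f (φ i)) := by
  induction k generalizing φ with
  | zero => rfl
  | succ k ih =>
    rw [pow_succ, pow_succ]
    change (fun i => f ((operator w S ^ k) (operator w S φ) i))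
      = (operator w T ^ k) (operator w T (fun i => f (φ i)))
    rw [ih]
    refine congrArg (operator w T ^ k) (funext fun i => ?_)
    exact (w i).eval.natural S T trivial trivial f φ

theorem powSucc_eq_pow {M : Type*} [Monoid M] (x : M) (k : ℕ) : powSucc x k = x ^ (k + 1) := by
  induction k with
  | zero => simp [powSucc]
  | succ k ih => rw [powSucc, ih, ← pow_succ]

/-- The implicit operation `a_j ∘ (w_1, …, w_n) ^ ω`: the `j`-th component of the idempotent power
of the operator `(w_1, …, w_n)`. -/
noncomputable def omegaComp {n : ℕ} (w : Fin n → KTerm (Fin n)) (j : Fin n) :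
    ImplicitOp allS (Fin n) where
  val S _ φ := (omegaPow (operator w S)) φ j
  natural S T _ _ f φ := by
    have hS := omegaPow_idem (operator w S)
    have hT := omegaPow_idem (operator w T)
    obtain ⟨a, ha⟩ : ∃ a, omegaPow (operator w S) = operator w S ^ (a + 1) :=
      ⟨_, powSucc_eq_pow _ _⟩
    obtain ⟨b, hb⟩ : ∃ b, omegaPow (operator w T) = operator w T ^ (b + 1) :=
      ⟨_, powSucc_eq_pow _ _⟩
    have hS' : omegaPow (operator w S) = operator w S ^ ((a + 1) * (b + 1)) := by
      rw [pow_mul, ← ha]; exact (IsIdempotentElem.pow_eq hS (Nat.succ_ne_zero b)).symm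
    have hT' : omegaPow (operator w T) = operator w T ^ ((a + 1) * (b + 1)) := by
      rw [mul_comm, pow_mul, ← hb]; exact (IsIdempotentElem.pow_eq hT (Nat.succ_ne_zero a)).symm
    rw [hS', hT']
    exact congrFun (operator_pow_natural w S T f _ φ) j

/-- The symbols of `σ` not in `κ`: an arity `n`, `κ`-terms `w_1, …, w_n` in `n` letters, `j ≤ n`, and
`m ≥ 1`, such that the matrix of exponent sums has non-zero determinant and every prime that
divides it divides `m`. -/
structure SigmaSym where
  n : ℕ
  w : Fin n → KTerm (Fin n)
  j : Fin n
  m : ℕ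
  m_pos : 0 < m
  det_ne_zero : (Matrix.of fun i k => (w i).expSum k).det ≠ 0
  prime_dvd : ∀ p : ℕ, p.Prime → (p : ℤ) ∣ (Matrix.of fun i k => (w i).expSum k).det → p ∣ m

/-- The implicit operation `(a_j ∘ (w_1, …, w_n) ^ ω) ^ (m ^ ω)`. -/
noncomputable def SigmaSym.op (s : SigmaSym) : ImplicitOp allS (Fin s.n) where
  val S _ φ := natOmegaPow s.m ((omegaComp s.w s.j).val S trivial φ)
  natural S T _ _ f φ := by
    rw [map_natOmegaPow, (omegaComp s.w s.j).natural S T trivial trivial f φ]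

/-- The signature `σ`. -/
def sigma : Signature := kappa ∪ {x | ∃ s : SigmaSym, x = ⟨s.n, s.op⟩}

/-- `σ`-terms over an alphabet. -/
inductive STerm (A : Type*) : Type _
  | var (a : A) : STerm A
  | mul (s t : STerm A) : STerm A
  | inv (t : STerm A) : STerm A
  | op (s : SigmaSym) (t : Fin s.n → STerm A) : STerm A

namespace STerm

variable {A : Type*}

/-- The pseudoword represented by a `σ`-term. -/
noncomputable def eval : STerm A → ImplicitOp allS A
  | var a => ImplicitOp.proj allS a
  | mul s t => mulOp.app ![s.eval, t.eval]
  | inv t => omegaInvOp.app ![t.eval]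
  | op s t => s.op.app (fun i => (t i).eval)

/-- The symbols from which codes of `σ`-terms are built: `Sum.inl` as for `κ`-terms, and
`Sum.inr (n, j, m, [w_1, …, w_n])` for a symbol of `σ` outside `κ`. -/
abbrev CodeSym := ℕ ⊕ (ℕ × ℕ × ℕ × List (List ℕ))

/-- The code of a `σ`-term in Polish notation. -/
def code (idx : A → ℕ) : STerm A → List CodeSym
  | var a => [Sum.inl (idx a + 2)]
  | mul s t => Sum.inl 0 :: (code idx s ++ code idx t)
  | inv t => Sum.inl 1 :: code idx t
  | op s t => Sum.inr (s.n, (s.j : ℕ), s.m, List.ofFn fun i => (s.w i).code Fin.val) ::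
      (List.ofFn fun i => code idx (t i)).flatten

end STerm

/-! ### Computability -/

/-- The number of a letter in an enumerated finite alphabet. -/
def letterIdx (A : Type*) [FinEnum A] (a : A) : ℕ := (FinEnum.equiv a : Fin (FinEnum.card A))

/-- An implicit operation `w` on `V` is computable: there is an algorithm which, given a member `S`
of `V` (by its multiplication table, for any numbering `e` of the elements) and `φ ∈ S ^ A` (as a
list), outputs the value `w_S(φ)`. -/
def ImplicitOp.IsComputable {V : FinSemigrp → Prop} {A : Type*} [FinEnum A]
    (w : ImplicitOp V A) : Prop :=
  ∃ f : List (List ℕ) → List ℕ → ℕ, Computable₂ f ∧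
    ∀ (S : FinSemigrp) (hS : V S) (N : ℕ) (e : S.carrier ≃ Fin N) (φ : A → S.carrier),
      f (List.ofFn fun i => List.ofFn fun j => (e (e.symm i * e.symm j) : ℕ))
        (List.ofFn fun i : Fin (FinEnum.card A) => (e (φ (FinEnum.equiv.symm i)) : ℕ))
        = (e (w.val S hS φ) : ℕ)

end Pseudo

open Pseudo

/-!
Over finite `p`-groups, every operation of `σ` outside `κ` is either a projection or the constant
`1`, depending only on whether `p` divides `m`.

If `p ∤ m`, then `p` does not divide the determinant of the matrix of exponent sums of
`(w_1, …, w_n)`. The operator `(w_1, …, w_n)` is then injective on `G ^ n` for every finite `p`-group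
`G` (`Pseudo.injective_groupEval`): by induction on the nilpotency class, two tuples with the same
image differ by a central tuple, the operator acts on central factors through the matrix, and
Cramer's rule shows that this tuple is trivial. Hence its idempotent power is the identity map and
`a_j ∘ (w_1, …, w_n) ^ ω` is the `j`-th projection; moreover `x ^ (m ^ ω) = x`, because
`m ^ (k !) ≡ 1` modulo any given power of `p` for large `k`. If `p ∣ m`, then `x ^ (m ^ ω) = 1`. Both
cases are recorded in `Pseudo.SigmaSym.op_val`.

So a `σ`-term becomes, in `G_p`, the `κ`-term `Pseudo.STerm.toKappa p` in which each such operation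
is replaced by its `j`-th argument `t` or by `t t ^ (ω - 1)`. The exceptional primes are those that
divide some `m` occurring in the term; for all other primes the resulting `κ`-term is the same.
On Polish codes this translation is a right fold with a stack, hence primitive recursive, and so
is the evaluation of a fixed `κ`-term from a multiplication table.
-/

namespace Pseudo

open scoped IsMulCommutative

/-! ### Operators on finite `p`-groups -/

section Groups

variable {G : Type*} [Group G]

/-- The value of a `κ`-term in a group, where `t ^ (ω - 1)` is read as the inverse of `t`. -/
def KTerm.groupEval {X : Type*} (φ : X → G) : KTerm X → G
  | .var x => φ x
  | .mul s t => s.groupEval φ * t.groupEval φ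
  | .inv t => (t.groupEval φ)⁻¹

theorem KTerm.map_groupEval {X H : Type*} [Group H] (f : G →* H) (φ : X → G) (t : KTerm X) :
    f (t.groupEval φ) = t.groupEval (fun x => f (φ x)) := by
  induction t with
  | var x => rfl
  | mul s t hs ht => simp [groupEval, hs, ht]
  | inv t ht => simp [groupEval, ht]

/-- Central factors of the arguments come out of the value of a term, raised to the exponent
sums. -/
theorem KTerm.groupEval_mul_center {X : Type*} [Fintype X] [DecidableEq X] (φ : X → G)
    (z : X → Subgroup.center G) (t : KTerm X) :
    t.groupEval (fun x => φ x * z x) =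
      t.groupEval φ * ((∏ x, z x ^ t.expSum x : Subgroup.center G) : G) := by
  induction t with
  | var y =>
    have : ∏ x, z x ^ (KTerm.var y).expSum x = z y := by
      rw [Finset.prod_eq_single y] <;> simp +contextual [expSum, eq_comm]
    rw [this]; rfl
  | mul s t hs ht =>
    have : ∏ x, z x ^ (KTerm.mul s t).expSum x
        = (∏ x, z x ^ s.expSum x) * ∏ x, z x ^ t.expSum x := by
      simp [expSum, zpow_add, Finset.prod_mul_distrib]
    rw [this, groupEval, hs, ht, groupEval, Subgroup.coe_mul]
    have := Subgroup.mem_center_iff.1 (∏ x, z x ^ s.expSum x).2 (t.groupEval φ)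
    simp only [mul_assoc]
    rw [← mul_assoc (t.groupEval φ), this, mul_assoc]
  | inv t ht =>
    have : ∏ x, z x ^ (KTerm.inv t).expSum x = (∏ x, z x ^ t.expSum x)⁻¹ := by
      simp [expSum, Finset.prod_inv_distrib]
    rw [this, groupEval, ht, groupEval, mul_inv_rev, Subgroup.coe_inv]
    exact (Subgroup.mem_center_iff.1 (∏ x, z x ^ t.expSum x)⁻¹.2 _).symm

/-- Cramer's rule in multiplicative notation: a solution of a homogeneous linear system over `ℤ`
in an abelian group is annihilated by the determinant. -/
theorem zpow_det_eq_one {n : Type*} [Fintype n] [DecidableEq n] {C : Type*} [CommGroup C]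
    (M : Matrix n n ℤ) (z : n → C) (h : ∀ i, ∏ k, z k ^ M i k = 1) (l : n) :
    z l ^ M.det = 1 := by
  calc z l ^ M.det = ∏ k, z k ^ (M.adjugate * M) l k := by
        rw [Matrix.adjugate_mul, Finset.prod_eq_single l] <;>
          simp +contextual [eq_comm]
    _ = ∏ i, (∏ k, z k ^ M i k) ^ M.adjugate l i := by
        simp_rw [Matrix.mul_apply, ← Finset.prod_zpow, ← zpow_mul, mul_comm (M _ _)]
        rw [Finset.prod_comm]
        refine Finset.prod_congr rfl fun k _ => ?_
        induction (Finset.univ : Finset n) using Finset.induction_on with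
        | empty => simp
        | insert i s hi ih => rw [Finset.sum_insert hi, Finset.prod_insert hi, zpow_add, ih]
    _ = 1 := by simp [h]

theorem eq_one_of_zpow_eq_one {p : ℕ} (hp : p.Prime) (hG : IsPGroup p G) {g : G} {d : ℤ}
    (hd : ¬ (p : ℤ) ∣ d) (h : g ^ d = 1) : g = 1 := by
  obtain ⟨k, hk⟩ := hG g
  have h1 : (orderOf g : ℤ) ∣ d := orderOf_dvd_iff_zpow_eq_one.2 h
  obtain ⟨j, -, hj⟩ := (Nat.dvd_prime_pow hp).1 (orderOf_dvd_of_pow_eq_one hk)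
  rcases Nat.eq_zero_or_pos j with rfl | hj0
  · exact orderOf_eq_one_iff.1 (by simpa using hj)
  · refine absurd (dvd_trans ?_ h1) hd
    rw [hj]
    exact_mod_cast dvd_pow_self p hj0.ne'

/-- Over a nilpotent `p`-group, an operator whose matrix of exponent sums is invertible modulo `p`
is injective. Two tuples with the same image agree modulo the centre by induction on the class, so
they differ by a central tuple `z`; this is a solution of the linear system given by the matrix,
hence trivial. -/
theorem injective_groupEval {p : ℕ} (hp : p.Prime) {n : ℕ} (w : Fin n → KTerm (Fin n))
    (hdet : ¬ (p : ℤ) ∣ (Matrix.of fun i k => (w i).expSum k).det)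
    [Group.IsNilpotent G] (hG : IsPGroup p G) :
    Function.Injective fun (φ : Fin n → G) i => (w i).groupEval φ := by
  revert hG
  refine Group.nilpotent_center_quotient_ind (P := fun G _ _ => IsPGroup p G →
    Function.Injective fun (φ : Fin n → G) i => (w i).groupEval φ) G ?_ ?_
  · intro G _ _ _ φ ψ _
    exact Subsingleton.elim _ _
  · intro G _ _ ih hG φ ψ h
    have hq : (fun i => (φ i : G ⧸ Subgroup.center G)) = fun i => (ψ i : G ⧸ Subgroup.center G) := by
      refine ih (hG.to_quotient _) (funext fun i => ?_)
      have := congrArg (QuotientGroup.mk' (Subgroup.center G)) (congrFun h i)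
      rwa [KTerm.map_groupEval, KTerm.map_groupEval] at this
    let z : Fin n → Subgroup.center G := fun i =>
      ⟨(ψ i)⁻¹ * φ i, QuotientGroup.eq.1 (congrFun hq i).symm⟩
    have hφ : φ = fun i => ψ i * z i := by
      funext i
      simp [z]
    have hz : ∀ i, ∏ k, z k ^ (Matrix.of fun i k => (w i).expSum k) i k = 1 := by
      intro i
      have := congrFun h i
      rw [hφ] at this
      simpa [KTerm.groupEval_mul_center] using this
    have hz1 : ∀ i, z i = 1 := fun i =>
      eq_one_of_zpow_eq_one hp (hG.to_subgroup _) hdet (zpow_det_eq_one _ z hz i)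
    rw [hφ]
    funext i
    simp [hz1]

theorem omegaPow_eq_one [Finite G] (g : G) : omegaPow g = 1 :=
  mul_eq_left.1 (omegaPow_idem g)

theorem omegaInv_eq_inv [Finite G] (g : G) : omegaInv g = g⁻¹ := by
  have := mul_omegaInv g
  rw [omegaPow_eq_one, one_mul] at this
  exact eq_inv_of_mul_eq_one_right this

theorem natOmegaPow_eq_one_of_dvd [Finite G] {p : ℕ} (hG : IsPGroup p G) {m : ℕ} (hm : 0 < m)
    (h : p ∣ m) (g : G) : natOmegaPow m g = 1 := by
  obtain ⟨a, ha⟩ := hG g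
  obtain ⟨k, hk, hka⟩ := ((natOmegaPow_spec m g).and (eventually_ge_atTop a)).exists
  rw [← hk, powSucc_eq_pow, Nat.sub_add_cancel (Nat.pow_pos hm)]
  obtain ⟨c, hc⟩ := (pow_dvd_pow p (hka.trans (Nat.self_le_factorial k))).trans
    (pow_dvd_pow_of_dvd h k.factorial)
  rw [hc, pow_mul, ha, one_pow]

theorem natOmegaPow_eq_self_of_not_dvd [Finite G] {p : ℕ} (hp : p.Prime) (hG : IsPGroup p G)
    {m : ℕ} (h : ¬ p ∣ m) (g : G) : natOmegaPow m g = g := by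
  obtain ⟨a, ha⟩ := hG g
  have hm : 0 < m := Nat.pos_of_ne_zero fun h0 => h (h0 ▸ dvd_zero p)
  obtain ⟨k, hk, hka⟩ :=
    ((natOmegaPow_spec m g).and (eventually_ge_atTop (Nat.totient (p ^ a)))).exists
  rw [← hk, powSucc_eq_pow, Nat.sub_add_cancel (Nat.pow_pos hm)]
  -- `k !` is a multiple of `φ (p ^ a)`, so that `m ^ k ! ≡ 1` modulo the order of `g`
  obtain ⟨c, hc⟩ := Nat.dvd_factorial (Nat.totient_pos.2 (pow_pos hp.pos a)) hka
  have hcop : Nat.Coprime m (p ^ a) :=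
    Nat.Coprime.pow_right a ((Nat.Prime.coprime_iff_not_dvd hp).2 h).symm
  have hmod : m ^ k.factorial ≡ 1 [MOD p ^ a] := by
    rw [hc, pow_mul]
    simpa using (Nat.ModEq.pow_totient hcop).pow c
  have := pow_eq_pow_iff_modEq.2 (hmod.of_dvd (orderOf_dvd_of_pow_eq_one ha))
  rw [this, pow_one]

end Groups

/-- The idempotent power of an injective self-map of a finite set is the identity. -/
theorem omegaPow_end_eq_one {α : Type*} [Finite α] (f : Function.End α)
    (hf : Function.Injective f) : omegaPow f = 1 := by
  have key : ∀ k, Function.Injective (powSucc f k : Function.End α) := by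
    intro k
    induction k with
    | zero => exact hf
    | succ k ih => exact ih.comp hf
  funext x
  exact key _ (congrFun (omegaPow_idem f) x)

theorem KTerm.map_eval {X G : Type*} [Group G] {S : FinSemigrp} (e : S.carrier ≃* G)
    (φ : X → S.carrier) (t : KTerm X) :
    e (t.eval.val S trivial φ) = t.groupEval (fun x => e (φ x)) := by
  have : Finite G := Finite.of_equiv _ e.toEquiv
  induction t with
  | var x => rfl
  | mul s t hs ht =>
    rw [groupEval, ← hs, ← ht, ← map_mul]
    rfl
  | inv t ht =>
    rw [groupEval, ← ht, ← omegaInv_eq_inv]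
    exact map_omegaInv (e : S.carrier →ₙ* G) _

/-- A symbol of `σ` outside `κ` is, over finite `p`-groups, either a projection or the constant
`1`, here written as the `κ`-word `x x ^ (ω - 1)`. -/
theorem SigmaSym.op_val {p : ℕ} (hp : p.Prime) {S : FinSemigrp} (hS : Gp p S) (s : SigmaSym)
    (φ : Fin s.n → S.carrier) :
    s.op.val S trivial φ = if p ∣ s.m then φ s.j * omegaInv (φ s.j) else φ s.j := by
  obtain ⟨G, _, hG, ⟨e⟩⟩ := hS
  have : Finite G := Finite.of_equiv _ e.toEquiv
  have : Fact p.Prime := ⟨hp⟩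
  have : Group.IsNilpotent G := hG.isNilpotent
  apply e.injective
  have hop : e (s.op.val S trivial φ)
      = natOmegaPow s.m (e ((omegaComp s.w s.j).val S trivial φ)) :=
    map_natOmegaPow (e : S.carrier →ₙ* G) _ _
  have hinv : e (omegaInv (φ s.j)) = (e (φ s.j))⁻¹ := by
    rw [← omegaInv_eq_inv]
    exact map_omegaInv (e : S.carrier →ₙ* G) _
  rw [hop]
  split_ifs with h
  · rw [natOmegaPow_eq_one_of_dvd hG s.m_pos h, map_mul, hinv, mul_inv_cancel]
  · rw [natOmegaPow_eq_self_of_not_dvd hp hG h]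
    have hinj : Function.Injective (operator s.w S) := by
      intro φ ψ hφψ
      have := injective_groupEval hp s.w (fun hd => h (s.prime_dvd p hp hd)) hG
        (a₁ := fun i => e (φ i)) (a₂ := fun i => e (ψ i)) (funext fun i => by
          beta_reduce
          rw [← KTerm.map_eval, ← KTerm.map_eval]
          exact congrArg e (congrFun hφψ i))
      funext i
      exact e.injective (congrFun this i)
    have : (omegaComp s.w s.j).val S trivial φ = φ s.j :=
      congrFun (congrFun (omegaPow_end_eq_one _ hinj) φ) s.j
    rw [this]

/-! ### From `σ`-terms to `κ`-terms -/

/-- The `κ`-term obtained from a `σ`-term by replacing, from the inside out, each operation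
`(a_j ∘ (w_1, …, w_n) ^ ω) ^ (m ^ ω)` by its `j`-th argument `t` when `p` does not divide `m`, and
by `t t ^ (ω - 1)` when it does. As `m ≥ 1`, for `p = 0` the first case always applies. -/
def STerm.toKappa {A : Type*} (p : ℕ) : STerm A → KTerm A
  | var a => .var a
  | mul s t => .mul (s.toKappa p) (t.toKappa p)
  | inv t => .inv (t.toKappa p)
  | op s t => if p ∣ s.m then .mul ((t s.j).toKappa p) (.inv ((t s.j).toKappa p))
      else (t s.j).toKappa p

theorem STerm.satisfies_toKappa {A : Type*} {p : ℕ} (hp : p.Prime) (u : STerm A) :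
    Satisfies (Gp p) u.eval (u.toKappa p).eval := by
  have key : ∀ (S : FinSemigrp), Gp p S → ∀ φ : A → S.carrier,
      u.eval.val S trivial φ = (u.toKappa p).eval.val S trivial φ := by
    intro S hS φ
    induction u with
    | var a => rfl
    | mul s t hs ht =>
      change s.eval.val S trivial φ * t.eval.val S trivial φ = _
      rw [hs, ht]; rfl
    | inv t ht =>
      change omegaInv (t.eval.val S trivial φ) = _
      rw [ht]; rfl
    | op s t ih =>
      refine (s.op_val hp hS _).trans ?_
      rw [toKappa, ih s.j]
      split_ifs <;> rfl
  ext S hS φ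
  exact key S hS φ

/-- The numbers `m` of the symbols `(a_j ∘ (w_1, …, w_n) ^ ω) ^ (m ^ ω)` in a code. -/
def codeExponents (c : List STerm.CodeSym) : List ℕ :=
  c.flatMap fun x => Sum.elim (fun _ => []) (fun y => [y.2.2.1]) x

theorem STerm.toKappa_eq_of_not_dvd {A : Type*} {idx : A → ℕ} {p : ℕ} (u : STerm A)
    (h : ∀ m ∈ codeExponents (u.code idx), ¬ p ∣ m) : u.toKappa p = u.toKappa 0 := by
  induction u with
  | var a => rfl
  | mul s t hs ht =>
    simp only [codeExponents, code, List.flatMap_cons, List.flatMap_append, List.mem_append] at h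
    rw [toKappa, toKappa, hs fun m hm => h m (by tauto), ht fun m hm => h m (by tauto)]
  | inv t ht =>
    rw [toKappa, toKappa, ht fun m hm => h m (List.mem_append_right _ hm)]
  | op s t ih =>
    have hj := ih s.j fun m hm => h m (by
      simp only [codeExponents, List.mem_flatMap] at hm ⊢
      obtain ⟨x, hx, hxm⟩ := hm
      refine ⟨x, List.mem_cons_of_mem _ (List.mem_flatten.2 ⟨_, ?_, hx⟩), hxm⟩
      exact List.mem_ofFn.2 ⟨s.j, rfl⟩)
    have hm : ¬ p ∣ s.m := h s.m (List.mem_append_left _ (List.mem_singleton_self _))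
    have h0 : ¬ 0 ∣ s.m := fun h0 => s.m_pos.ne' (zero_dvd_iff.1 h0)
    rw [toKappa, toKappa, if_neg hm, if_neg h0, hj]

theorem STerm.codeExponents_pos {A : Type*} {idx : A → ℕ} (u : STerm A) :
    ∀ m ∈ codeExponents (u.code idx), 0 < m := by
  induction u with
  | var a => simp [code, codeExponents]
  | mul s t hs ht =>
    intro m hm
    simp only [codeExponents, code, List.flatMap_cons, List.flatMap_append, List.mem_append,
      Sum.elim_inl, List.not_mem_nil, false_or] at hm
    exact hm.elim (hs m) (ht m)
  | inv t ht =>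
    intro m hm
    exact ht m (by simpa [codeExponents, code] using hm)
  | op s t ih =>
    intro m hm
    rcases List.mem_append.1 hm with hm | hm
    · rw [List.mem_singleton.1 hm]; exact s.m_pos
    · obtain ⟨x, hx, hxm⟩ := List.mem_flatMap.1 hm
      obtain ⟨l, hl, hxl⟩ := List.mem_flatten.1 hx
      obtain ⟨i, rfl⟩ := List.mem_ofFn.1 hl
      exact ih i m (List.mem_flatMap.2 ⟨x, hxl, hxm⟩)

/-! ### Translation of codes -/

/-- One step of the translation of Polish codes, which are read from right to left. The stack `st`
holds the translations of the terms read so far and not yet used as arguments. -/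
def toKappaStep (p : ℕ) (x : STerm.CodeSym) (st : List (List ℕ)) : List (List ℕ) :=
  Sum.elim
    (fun k => if k = 0 then (0 :: (st.getD 0 [] ++ st.getD 1 [])) :: st.drop 2
      else if k = 1 then (1 :: st.getD 0 []) :: st.drop 1 else [k] :: st)
    (fun y => (if p ∣ y.2.2.1 then 0 :: (st.getD y.2.1 [] ++ 1 :: st.getD y.2.1 [])
      else st.getD y.2.1 []) :: st.drop y.1) x

/-- The code of `u.toKappa p`, computed from the code of `u`. -/
def toKappaCode (c : List STerm.CodeSym) (p : ℕ) : List ℕ :=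
  (c.foldr (toKappaStep p) []).getD 0 []

theorem STerm.foldr_toKappaStep {A : Type*} (idx : A → ℕ) (p : ℕ) (u : STerm A)
    (st : List (List ℕ)) :
    (u.code idx).foldr (toKappaStep p) st = (u.toKappa p).code idx :: st := by
  induction u generalizing st with
  | var a => simp [code, toKappaStep, toKappa, KTerm.code]
  | mul s t hs ht => simp [code, hs, ht, toKappaStep, toKappa, KTerm.code]
  | inv t ht => simp [code, ht, toKappaStep, toKappa, KTerm.code]
  | op s t ih =>
    have key : ∀ (n : ℕ) (t : Fin n → STerm A)
        (_ : ∀ i st, ((t i).code idx).foldr (toKappaStep p) st = ((t i).toKappa p).code idx :: st),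
        (List.ofFn fun i => (t i).code idx).flatten.foldr (toKappaStep p) st
          = (List.ofFn fun i => ((t i).toKappa p).code idx) ++ st := by
      intro n
      induction n with
      | zero => intro t _; simp
      | succ n ihn =>
        intro t h
        rw [List.ofFn_succ, List.ofFn_succ, List.flatten_cons, List.foldr_append,
          ihn _ fun i => h i.succ, h, List.cons_append]
    have hget : ((List.ofFn fun i => ((t i).toKappa p).code idx) ++ st).getD s.j []
        = ((t s.j).toKappa p).code idx := by
      rw [List.getD_append _ _ _ _ (by simp), List.getD_eq_getElem _ _ (by simp)]
      simp
    have hdrop : ((List.ofFn fun i => ((t i).toKappa p).code idx) ++ st).drop s.n = st := by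
      simp
    rw [code, List.foldr_cons, key _ _ ih, toKappaStep, Sum.elim_inr, hget, hdrop, toKappa]
    split_ifs <;> rfl

theorem STerm.toKappaCode_code {A : Type*} (idx : A → ℕ) (p : ℕ) (u : STerm A) :
    toKappaCode (u.code idx) p = (u.toKappa p).code idx := by
  rw [toKappaCode, foldr_toKappaStep, List.getD_cons_zero]

theorem primrecRel_dvd : PrimrecRel fun a b : ℕ => a ∣ b :=
  (Primrec.eq.comp (Primrec.nat_mod.comp Primrec.snd Primrec.fst) (Primrec.const 0)).of_eq
    fun _ => Nat.dvd_iff_mod_eq_zero.symm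

theorem primrec_toKappaStep :
    Primrec fun x : ℕ × STerm.CodeSym × List (List ℕ) => toKappaStep x.1 x.2.1 x.2.2 := by
  have hst : Primrec fun x : (ℕ × STerm.CodeSym × List (List ℕ)) × ℕ => x.1.2.2 :=
    Primrec.snd.comp (Primrec.snd.comp Primrec.fst)
  have hst' : Primrec fun x : (ℕ × STerm.CodeSym × List (List ℕ)) × (ℕ × ℕ × ℕ × List (List ℕ)) =>
      x.1.2.2 := Primrec.snd.comp (Primrec.snd.comp Primrec.fst)
  have hget : ∀ n, Primrec fun x : (ℕ × STerm.CodeSym × List (List ℕ)) × ℕ =>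
      x.1.2.2.getD n [] := fun n => (Primrec.list_getD []).comp hst (Primrec.const n)
  have hget' : Primrec fun x : (ℕ × STerm.CodeSym × List (List ℕ)) × (ℕ × ℕ × ℕ × List (List ℕ)) =>
      x.1.2.2.getD x.2.2.1 [] :=
    (Primrec.list_getD []).comp hst' (Primrec.fst.comp (Primrec.snd.comp Primrec.snd))
  have hdrop : ∀ n, Primrec fun x : (ℕ × STerm.CodeSym × List (List ℕ)) × ℕ =>
      x.1.2.2.drop n := fun n => Primrec.list_drop.comp (Primrec.const n) hst
  refine Primrec.sumCasesOn (Primrec.fst.comp Primrec.snd)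
    (g := fun x k => if k = 0 then (0 :: (x.2.2.getD 0 [] ++ x.2.2.getD 1 [])) :: x.2.2.drop 2
      else if k = 1 then (1 :: x.2.2.getD 0 []) :: x.2.2.drop 1 else [k] :: x.2.2)
    (h := fun x y => (if x.1 ∣ y.2.2.1 then 0 :: (x.2.2.getD y.2.1 [] ++ 1 :: x.2.2.getD y.2.1 [])
      else x.2.2.getD y.2.1 []) :: x.2.2.drop y.1) ?_ ?_ |>.of_eq fun x => ?_
  · refine Primrec.ite (Primrec.eq.comp Primrec.snd (Primrec.const 0)) ?_
      (Primrec.ite (Primrec.eq.comp Primrec.snd (Primrec.const 1)) ?_ ?_)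
    · exact Primrec.list_cons.comp (Primrec.list_cons.comp (Primrec.const 0)
        (Primrec.list_append.comp (hget 0) (hget 1))) (hdrop 2)
    · exact Primrec.list_cons.comp (Primrec.list_cons.comp (Primrec.const 1) (hget 0)) (hdrop 1)
    · exact Primrec.list_cons.comp (Primrec.list_cons.comp Primrec.snd (Primrec.const [])) hst
  · refine Primrec.list_cons.comp (Primrec.ite (primrecRel_dvd.comp (Primrec.fst.comp Primrec.fst)
      (Primrec.fst.comp (Primrec.snd.comp (Primrec.snd.comp Primrec.snd)))) ?_ hget')
      (Primrec.list_drop.comp (Primrec.fst.comp Primrec.snd) hst')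
    exact Primrec.list_cons.comp (Primrec.const 0) (Primrec.list_append.comp hget'
      (Primrec.list_cons.comp (Primrec.const 1) hget'))
  · obtain ⟨p, x | x, st⟩ := x <;> rfl

theorem primrec_toKappaCode : Primrec₂ toKappaCode := by
  refine (Primrec.list_getD []).comp ?_ (Primrec.const 0)
  refine Primrec.list_foldr Primrec.fst (Primrec.const []) (h := fun x y =>
    toKappaStep x.2 y.1 y.2) ?_
  exact primrec_toKappaStep.comp (Primrec.pair (Primrec.snd.comp Primrec.fst)
    (Primrec.pair (Primrec.fst.comp Primrec.snd) (Primrec.snd.comp Primrec.snd)))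

/-! ### The exceptional primes -/

theorem primrecPred_prime : PrimrecPred Nat.Prime := by
  have h1 : PrimrecRel fun d p : ℕ => ¬ d ∣ p ∨ d < 2 := by
    refine PrimrecPred.or (PrimrecPred.not primrecRel_dvd)
      (Primrec.nat_lt.comp Primrec.fst (Primrec.const 2))
  refine PrimrecPred.of_eq (PrimrecPred.and
    (Primrec.nat_le.comp (Primrec.const 2) Primrec.id)
    ((PrimrecRel.forall_lt h1).comp Primrec.id Primrec.id)) fun p => ?_
  rw [Nat.prime_def_lt']
  refine and_congr_right fun _ => forall_congr' fun d => ?_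
  simp only [id]
  constructor
  · intro h h2 hd; have := h hd; omega
  · intro h hd; by_cases hd2 : d < 2
    · exact Or.inr hd2
    · exact Or.inl (h (by omega) hd)

/-- The prime divisors of the numbers `m` in a code. -/
def badPrimes (c : List STerm.CodeSym) : List ℕ :=
  (codeExponents c).flatMap fun m => (List.range (m + 1)).filter fun p => p.Prime ∧ p ∣ m

theorem primrec_badPrimes : Primrec badPrimes := by
  refine Primrec.list_flatMap (Primrec.list_flatMap Primrec.id ?_) ?_
  · refine (Primrec.sumCasesOn Primrec.snd (g := fun _ _ => ([] : List ℕ))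
      (h := fun _ y => [y.2.2.1]) (Primrec.const []) ?_).of_eq fun x => ?_
    · exact Primrec.list_cons.comp (Primrec.fst.comp (Primrec.snd.comp (Primrec.snd.comp
        Primrec.snd))) (Primrec.const [])
    · obtain ⟨_, x | x⟩ := x <;> rfl
  · have h : PrimrecRel fun p m : ℕ => p.Prime ∧ p ∣ m :=
      PrimrecPred.and (primrecPred_prime.comp Primrec.fst) primrecRel_dvd
    exact (PrimrecRel.listFilter h).comp
      (Primrec.list_range.comp (Primrec.succ.comp Primrec.snd)) Primrec.snd

theorem prime_of_mem_badPrimes {c : List STerm.CodeSym} {p : ℕ} (h : p ∈ badPrimes c) :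
    p.Prime := by
  simp only [badPrimes, List.mem_flatMap, List.mem_filter, decide_eq_true_eq] at h
  obtain ⟨_, _, _, h, _⟩ := h
  exact h

theorem STerm.not_dvd_of_notMem_badPrimes {A : Type*} {idx : A → ℕ} {u : STerm A} {p : ℕ}
    (hp : p.Prime) (h : p ∉ badPrimes (u.code idx)) :
    ∀ m ∈ codeExponents (u.code idx), ¬ p ∣ m := by
  intro m hm hd
  refine h (List.mem_flatMap.2 ⟨m, hm, List.mem_filter.2 ⟨List.mem_range.2 ?_, ?_⟩⟩)
  · exact Nat.lt_succ_of_le (Nat.le_of_dvd (u.codeExponents_pos m hm) hd)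
  · exact decide_eq_true ⟨hp, hd⟩

/-- Away from the exceptional primes the translation does not depend on the prime. -/
theorem STerm.satisfies_toKappa_zero {A : Type*} {idx : A → ℕ} {p : ℕ} (hp : p.Prime)
    (u : STerm A) (h : p ∉ badPrimes (u.code idx)) :
    Satisfies (Gp p) u.eval (u.toKappa 0).eval := by
  rw [← u.toKappa_eq_of_not_dvd (not_dvd_of_notMem_badPrimes hp h)]
  exact u.satisfies_toKappa hp

/-! ### Computability of `κ`-words -/

/-- The product of `i` and `j` according to a multiplication table. -/
def tableMul (tab : List (List ℕ)) (i j : ℕ) : ℕ := (tab.getD i []).getD j 0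

/-- The power `i ^ (k + 1)` according to a multiplication table. -/
def tablePow (tab : List (List ℕ)) (i k : ℕ) : ℕ := Nat.rec i (fun _ y => tableMul tab y i) k

/-- The value of a `κ`-term in the semigroup with multiplication table `tab`, the values of the
letters being listed in `l`. -/
def KTerm.tableEval {A : Type*} [FinEnum A] (tab : List (List ℕ)) (l : List ℕ) : KTerm A → ℕ
  | var a => l.getD (letterIdx A a) 0
  | mul s t => tableMul tab (s.tableEval tab l) (t.tableEval tab l)
  | inv t => tablePow tab (t.tableEval tab l) (2 * tab.length.factorial - 2)

theorem primrec_tableMul :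
    Primrec fun x : List (List ℕ) × ℕ × ℕ => tableMul x.1 x.2.1 x.2.2 :=
  (Primrec.list_getD 0).comp ((Primrec.list_getD []).comp Primrec.fst
    (Primrec.fst.comp Primrec.snd)) (Primrec.snd.comp Primrec.snd)

theorem primrec_tablePow :
    Primrec fun x : List (List ℕ) × ℕ × ℕ => tablePow x.1 x.2.1 x.2.2 := by
  refine Primrec.nat_rec' (Primrec.snd.comp Primrec.snd) (Primrec.fst.comp Primrec.snd)
    (h := fun x y => tableMul x.1 y.2 x.2.1) ?_
  exact primrec_tableMul.comp (Primrec.pair (Primrec.fst.comp Primrec.fst)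
    (Primrec.pair (Primrec.snd.comp Primrec.snd)
      (Primrec.fst.comp (Primrec.snd.comp Primrec.fst))))

theorem primrec_factorial : Primrec Nat.factorial := by
  refine (Primrec.nat_rec₁ (f := fun n r => (n + 1) * r) 1
    (Primrec.nat_mul.comp (Primrec.succ.comp Primrec.fst) Primrec.snd)).of_eq fun n => ?_
  induction n with
  | zero => rfl
  | succ n ih => rw [Nat.factorial_succ, ← ih]

theorem KTerm.primrec_tableEval {A : Type*} [FinEnum A] (t : KTerm A) :
    Primrec₂ fun tab l => t.tableEval tab l := by
  induction t with
  | var a => exact (Primrec.list_getD 0).comp Primrec.snd (Primrec.const _)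
  | mul s t hs ht => exact primrec_tableMul.comp (Primrec.pair Primrec.fst (Primrec.pair hs ht))
  | inv t ht =>
    refine primrec_tablePow.comp (Primrec.pair Primrec.fst (Primrec.pair ht ?_))
    exact Primrec.nat_sub.comp (Primrec.nat_mul.comp (Primrec.const 2)
      (primrec_factorial.comp (Primrec.list_length.comp Primrec.fst))) (Primrec.const 2)

theorem KTerm.isComputable_eval {A : Type*} [FinEnum A] (t : KTerm A) :
    t.eval.IsComputable := by
  refine ⟨fun tab l => t.tableEval tab l, t.primrec_tableEval.to_comp, ?_⟩
  intro S _ N e φ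
  set tab := List.ofFn fun i => List.ofFn fun j => (e (e.symm i * e.symm j) : ℕ) with htab
  have hmul : ∀ x y : S.carrier, tableMul tab (e x) (e y) = e (x * y) := by
    intro x y
    have h1 : tab.getD (e x) [] = List.ofFn fun j => (e (e.symm (e x) * e.symm j) : ℕ) := by
      rw [List.getD_eq_getElem _ _ (by simp [htab])]
      simp [htab]
    rw [tableMul, h1, List.getD_eq_getElem _ _ (by simp)]
    simp
  have hpow : ∀ (x : S.carrier) (k : ℕ), tablePow tab (e x) k = e (powSucc x k) := by
    intro x k
    induction k with
    | zero => rfl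
    | succ k ih => rw [powSucc, ← hmul, ← ih]; rfl
  have hcard : tab.length = Nat.card S.carrier := by
    rw [Nat.card_congr e, Nat.card_fin, htab, List.length_ofFn]
  beta_reduce
  induction t with
  | var a =>
    rw [tableEval, List.getD_eq_getElem _ _ (by simp [letterIdx])]
    simp [letterIdx, eval, ImplicitOp.proj]
  | mul s t hs ht =>
    rw [tableEval, hs, ht, hmul]; rfl
  | inv t ht =>
    rw [tableEval, ht, hpow, hcard]; rfl

/-! ### The subalgebras generated by the letters -/

theorem ImplicitOp.app_mulOp {V : FinSemigrp → Prop} {A : Type*} (u : Fin 2 → ImplicitOp V A) :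
    mulOp.app u = mulOp.app ![u 0, u 1] := by
  congr 1
  funext i
  fin_cases i <;> rfl

theorem ImplicitOp.app_omegaInvOp {V : FinSemigrp → Prop} {A : Type*}
    (u : Fin 1 → ImplicitOp V A) : omegaInvOp.app u = omegaInvOp.app ![u 0] := by
  congr 1
  funext i
  fin_cases i; rfl

theorem mulOp_mem_kappa : (⟨2, mulOp⟩ : Σ n, ImplicitOp allS (Fin n)) ∈ kappa := Or.inl rfl

theorem omegaInvOp_mem_kappa : (⟨1, omegaInvOp⟩ : Σ n, ImplicitOp allS (Fin n)) ∈ kappa :=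
  Or.inr rfl

theorem KTerm.eval_mem_omega {A : Type*} (t : KTerm A) : t.eval ∈ Omega kappa allS A := by
  induction t with
  | var a => exact Omega.gen a
  | mul s t hs ht =>
    refine Omega.app mulOp mulOp_mem_kappa _ fun i => ?_
    fin_cases i
    · exact hs
    · exact ht
  | inv t ht =>
    refine Omega.app omegaInvOp omegaInvOp_mem_kappa _ fun i => ?_
    fin_cases i
    exact ht

theorem exists_sterm_of_mem_omega {A : Type*} {u : ImplicitOp allS A}
    (hu : u ∈ Omega sigma allS A) : ∃ t : STerm A, t.eval = u := by
  induction hu with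
  | gen a => exact ⟨.var a, rfl⟩
  | app w hw u _ ih =>
    choose t ht using ih
    rcases hw with (hw | hw) | ⟨s, hw⟩
    · cases hw
      exact ⟨.mul (t 0) (t 1), by rw [STerm.eval, ht, ht, ← ImplicitOp.app_mulOp]⟩
    · cases hw
      exact ⟨.inv (t 0), by rw [STerm.eval, ht, ← ImplicitOp.app_omegaInvOp]⟩
    · cases hw
      exact ⟨.op s t, by rw [STerm.eval]; simp only [ht]⟩

theorem omega_sigma_Gp_eq {A : Type*} {p : ℕ} (hp : p.Prime) :
    Omega sigma (Gp p) A = Omega kappa (Gp p) A := by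
  apply Set.Subset.antisymm
  · intro u hu
    induction hu with
    | gen a => exact Omega.gen a
    | app w hw u _ ih =>
      rcases hw with hw | ⟨s, hw⟩
      · exact Omega.app w hw u ih
      · cases hw
        by_cases h : p ∣ s.m
        · have : s.op.app u = mulOp.app ![u s.j, omegaInvOp.app ![u s.j]] := by
            ext S hS φ
            exact (s.op_val hp hS _).trans (if_pos h)
          rw [this]
          refine Omega.app mulOp mulOp_mem_kappa _ fun i => ?_
          fin_cases i
          · exact ih s.j
          · refine Omega.app omegaInvOp omegaInvOp_mem_kappa _ fun i => ?_
            fin_cases i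
            exact ih s.j
        · have : s.op.app u = u s.j := by
            ext S hS φ
            exact (s.op_val hp hS _).trans (if_neg h)
          rw [this]
          exact ih s.j
  · intro u hu
    induction hu with
    | gen a => exact Omega.gen a
    | app w hw u _ ih => exact Omega.app w (Or.inl hw) u ih

end Pseudo

theorem mainTheorem5 {A : Type*} [FinEnum A] :
    -- there are algorithms that compute, from a `σ`-term `u`, the finite complement of `S(u)`, the
    -- `κ`-word `w₀`, and the `κ`-word `w_i` for each prime `p_i` outside `S(u)`
    (∃ (bad : List STerm.CodeSym → List ℕ) (w₀ : List STerm.CodeSym → List ℕ)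
        (w : List STerm.CodeSym → ℕ → List ℕ),
      Computable bad ∧ Computable w₀ ∧ Computable₂ w ∧
      ∀ u : STerm A,
        (∀ p ∈ bad (u.code (letterIdx A)), p.Prime) ∧
        (∃ t₀ : KTerm A, t₀.code (letterIdx A) = w₀ (u.code (letterIdx A)) ∧
          ∀ p : ℕ, p.Prime → p ∉ bad (u.code (letterIdx A)) →
            Satisfies (Gp p) u.eval t₀.eval) ∧
        (∀ p ∈ bad (u.code (letterIdx A)), ∃ t : KTerm A,
          t.code (letterIdx A) = w (u.code (letterIdx A)) p ∧
            Satisfies (Gp p) u.eval t.eval)) ∧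
    -- every pseudoword `u` in the `σ`-algebra has such a set `S(u)` and such computable `κ`-words
    (∀ u ∈ Omega sigma allS A, ∃ P : Set ℕ,
      P ⊆ {p | p.Prime} ∧ ({p | p.Prime} \ P).Finite ∧ ComputablePred (· ∈ P) ∧
      (∃ w₀ ∈ Omega kappa allS A, w₀.IsComputable ∧
        ∀ p ∈ P, Satisfies (Gp p) u w₀) ∧
      (∀ p ∈ {p : ℕ | p.Prime} \ P, ∃ w ∈ Omega kappa allS A, w.IsComputable ∧
        Satisfies (Gp p) u w)) ∧
    (∀ p : ℕ, p.Prime → Omega sigma (Gp p) A = Omega kappa (Gp p) A) := by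
  refine ⟨⟨badPrimes, fun c => toKappaCode c 0, toKappaCode, primrec_badPrimes.to_comp,
    (primrec_toKappaCode.comp Primrec.id (Primrec.const 0)).to_comp, primrec_toKappaCode.to_comp,
    fun u => ⟨fun p => prime_of_mem_badPrimes, ?_, ?_⟩⟩, ?_, fun p => omega_sigma_Gp_eq⟩
  · exact ⟨u.toKappa 0, (u.toKappaCode_code _ 0).symm, fun p hp h =>
      u.satisfies_toKappa_zero hp h⟩
  · exact fun p hp => ⟨u.toKappa p, (u.toKappaCode_code _ p).symm,
      u.satisfies_toKappa (prime_of_mem_badPrimes hp)⟩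
  · intro v hv
    obtain ⟨u, rfl⟩ := exists_sterm_of_mem_omega hv
    refine ⟨{p | p.Prime ∧ p ∉ badPrimes (u.code (letterIdx A))}, fun p hp => hp.1, ?_, ?_, ?_, ?_⟩
    · refine (badPrimes (u.code (letterIdx A))).finite_toSet.subset fun p hp => ?_
      by_contra h
      exact hp.2 ⟨hp.1, h⟩
    · have hmem : PrimrecPred fun p => ∃ q ∈ badPrimes (u.code (letterIdx A)), q = p :=
        (PrimrecRel.exists_mem_list Primrec.eq).comp (Primrec.const _) Primrec.id
      obtain ⟨hdec, h⟩ := primrecPred_prime.and hmem.not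
      have hiff : ∀ p, (p.Prime ∧ ¬ ∃ q ∈ badPrimes (u.code (letterIdx A)), q = p) ↔
          p ∈ {p | p.Prime ∧ p ∉ badPrimes (u.code (letterIdx A))} := fun p => by simp
      exact ⟨fun p => decidable_of_iff _ (hiff p), h.to_comp.of_eq fun p =>
        decide_eq_decide.2 (hiff p)⟩
    · exact ⟨(u.toKappa 0).eval, (u.toKappa 0).eval_mem_omega, (u.toKappa 0).isComputable_eval,
        fun p hp => u.satisfies_toKappa_zero hp.1 hp.2⟩
    · exact fun p hp => ⟨(u.toKappa p).eval, (u.toKappa p).eval_mem_omega,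
        (u.toKappa p).isComputable_eval, u.satisfies_toKappa hp.1⟩
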